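/- Consider a tabular finite-horizon POMDP: finite state, action and observation spaces $\mathcal S$, $\mathcal A$, $\mathcal O$ with $S=|\mathcal S|$ and $O=|\mathcal O|$, a horizon $H$, an initial distribution on $\mathcal S$, rewards $r_h:\mathcal O\to[0,1]$, transition kernels $\mathbb T_h(\cdot\mid s,a)$, and emission matrices $\mathbb O_h=(\mathbb O_h(o\mid s))_{o,s}\in\mathbb R^{\mathcal O\times\mathcal S}$ whose columns are probability distributions on $\mathcal O$, for $h=1,\dots,H$. For $\alpha\in(0,1]$, the POMDP is called $\alpha$-distinguishable if $\|\mathbb O_h(e_i-e_j)\|_1\ge\alpha$ for all $h$ and all $i\ne j$ in $\mathcal S$, where $e_i$ denotes the $i$-th standard basis vector of $\mathbb R^{\mathcal S}$. For an integer $k\ge1$, let $\mathbb O_h^{\otimes k}\in\mathbb R^{\mathcal O^k\times\mathcal S}$ be the matrix with entries $\mathbb O_h^{\otimes k}(o_1,\dots,o_k\mid s)=\prod_{i=1}^k\mathbb O_h(o_i\mid s)$. For $\beta\in(0,1]$, the POMDP is called $(\beta,k)$-MO-revealing if for every $h$ the matrix $\mathbb O_h^{\otimes k}$ has a left inverse $L_h\in\mathbb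 R^{\mathcal S\times\mathcal O^k}$ (that is, $L_h\,\mathbb O_h^{\otimes k}=I$) with $\|L_h\|_{1\to1}\le\beta^{-1}$, where $\|\cdot\|_{1\to1}$ is the operator norm with respect to the $\ell^1$ norms. **Theorem.** There exists an absolute constant $C>0$ such that, for every $\alpha\in(0,1]$, every $\alpha$-distinguishable tabular POMDP is $(1/2,k)$-MO-revealing for every integer $k\ge1$ with $$k\ \ge\ \frac{C\sqrt{O}\,\log(SO)}{\alpha^2}.$$ That is, for each such $k$, every matrix $\mathbb O_h^{\otimes k}$ has a left inverse of $(1\to1)$-norm at most $2$. -/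

import Mathlib

noncomputable section

/-- A tabular finite-horizon POMDP with finite state, action and observation spaces `S`, `A`, `O`
and horizon `H`; the steps `1, …, H` are indexed by `Fin H`. -/
structure POMDP (S A O : Type*) [Fintype S] [Fintype A] [Fintype O] (H : ℕ) where
  /-- Initial distribution over states. -/
  init : S → ℝ
  init_mem : init ∈ stdSimplex ℝ S
  /-- Rewards, functions of the observation with values in `[0, 1]`. -/
  reward : Fin H → O → ℝ
  reward_mem : ∀ h o, reward h o ∈ Set.Icc (0 : ℝ) 1
  /-- `transition h s a s'` is the probability of moving from `s` to `s'` under action `a`. -/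
  transition : Fin H → S → A → S → ℝ
  transition_mem : ∀ h s a, transition h s a ∈ stdSimplex ℝ S
  /-- The emission matrices: `emission h o s` is the probability of observing `o` in state `s`. -/
  emission : Fin H → Matrix O S ℝ
  emission_mem : ∀ h s, (fun o => emission h o s) ∈ stdSimplex ℝ O

/-- The column-wise `k`-fold self-tensor of a matrix, whose entry at `(o₁, …, o_k)` and `s`
is `∏ i, M (o i) s`. -/
def Matrix.tensorPow {S O : Type*} (M : Matrix O S ℝ) (k : ℕ) : Matrix (Fin k → O) S ℝ :=
  Matrix.of fun o s => ∏ i, M (o i) s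

/-- The `ℓ¹` norm of a real vector. -/
def l1Norm {n : Type*} [Fintype n] (x : n → ℝ) : ℝ :=
  ‖WithLp.toLp 1 x‖

/-- The `(1 → 1)` norm of a real matrix: the operator norm of the linear map it defines
between spaces of column vectors with the `ℓ¹` norm. -/
def Matrix.norm1to1 {m n : Type*} [Fintype m] [Fintype n] [DecidableEq n]
    (M : Matrix m n ℝ) : ℝ :=
  ‖LinearMap.toContinuousLinearMap (Matrix.toLpLin 1 1 M)‖

namespace POMDP

variable {S A O : Type*} [Fintype S] [Fintype A] [Fintype O] {H : ℕ}

/-- At every step, the emission distributions of any two different states are at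
`ℓ¹` distance at least `α`. -/
def IsDistinguishable [DecidableEq S] (P : POMDP S A O H) (α : ℝ) : Prop :=
  ∀ h : Fin H, ∀ i j : S, i ≠ j →
    α ≤ l1Norm ((P.emission h).mulVec (Pi.single i 1 - Pi.single j 1))

/-- `(α, k)`-MO-revealing: at every step, the `k`-fold self-tensor of the emission matrix has a
left inverse whose `(1 → 1)` norm is at most `α⁻¹`. -/
def IsMORevealing [DecidableEq S] [DecidableEq O] (P : POMDP S A O H) (α : ℝ) (k : ℕ) : Prop :=
  ∀ h : Fin H, ∃ L : Matrix S (Fin k → O) ℝ,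
    L * (P.emission h).tensorPow k = 1 ∧ L.norm1to1 ≤ α⁻¹

end POMDP

end

open Finset

/-! Guess the state from `k` observations by maximum likelihood, encoded as a 0/1 matrix `D`. With
`T` the tensor power, each probability of decoding `s` as `t ≠ s` is at most the Bhattacharyya
coefficient of the two columns of `T`. That coefficient is the `k`-th power of the one-step
coefficient, which `α`-separation bounds by `exp (-α²/8)`. Once `k α² / 8 ≥ log (4S)`, each
confusion probability is at most `1/(4S)`, so `D * T` is within `1/2` of the identity, and `(D *
T)⁻¹ * D` is a left inverse of norm at most `2`. The factor `√O` is not needed. -/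

lemma l1Norm_eq_sum {n : Type*} [Fintype n] (x : n → ℝ) : l1Norm x = ∑ i, |x i| := by
  simp [l1Norm, PiLp.norm_eq_of_L1]

/-- A bound on the `ℓ¹` norms of images bounds the `(1 → 1)` norm. -/
lemma Matrix.norm1to1_le {m n : Type*} [Fintype m] [Fintype n] [DecidableEq n]
    (M : Matrix m n ℝ) {c : ℝ} (hc : 0 ≤ c)
    (h : ∀ x : n → ℝ, ∑ i, |M.mulVec x i| ≤ c * ∑ j, |x j|) : M.norm1to1 ≤ c := by
  refine ContinuousLinearMap.opNorm_le_bound _ hc fun x => ?_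
  have := h (WithLp.ofLp x)
  rw [PiLp.norm_eq_of_L1, PiLp.norm_eq_of_L1]
  simpa [Matrix.toLpLin_apply] using this

/-- A matrix contracts `ℓ¹` norms by the largest `ℓ¹` norm of its columns. -/
lemma Matrix.sum_abs_mulVec_le {m n : Type*} [Fintype m] [Fintype n]
    (M : Matrix m n ℝ) {c : ℝ} (h : ∀ j, ∑ i, |M i j| ≤ c) (x : n → ℝ) :
    ∑ i, |M.mulVec x i| ≤ c * ∑ j, |x j| := by
  calc ∑ i, |M.mulVec x i| ≤ ∑ i, ∑ j, |M i j| * |x j| := by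
        refine sum_le_sum fun i _ => ?_
        simp only [Matrix.mulVec, dotProduct, ← abs_mul]
        exact abs_sum_le_sum_abs _ _
    _ = ∑ j, (∑ i, |M i j|) * |x j| := by
        rw [sum_comm]
        simp only [sum_mul]
    _ ≤ ∑ j, c * |x j| :=
        sum_le_sum fun j _ => mul_le_mul_of_nonneg_right (h j) (abs_nonneg _)
    _ = c * ∑ j, |x j| := (mul_sum _ _ _).symm

/-- The Bhattacharyya coefficient of two probability distributions is bounded in terms of their
`ℓ¹` distance. -/
lemma sq_sum_sqrt_mul_le {O : Type*} [Fintype O] {p q : O → ℝ} (hp : p ∈ stdSimplex ℝ O)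
    (hq : q ∈ stdSimplex ℝ O) :
    (∑ o, √(p o * q o)) ^ 2 ≤ 1 - (∑ o, |p o - q o|) ^ 2 / 4 := by
  have hsp : ∀ o, √(p o) ^ 2 = p o := fun o => Real.sq_sqrt (hp.1 o)
  have hsq : ∀ o, √(q o) ^ 2 = q o := fun o => Real.sq_sqrt (hq.1 o)
  have hmul : ∀ o, √(p o * q o) = √(p o) * √(q o) := fun o => Real.sqrt_mul (hp.1 o) _
  -- Cauchy–Schwarz on this factorization gives `(2 - 2B)(2 + 2B) = 4(1 - B²)`, with `B` the
  -- coefficient.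
  have habs : ∀ o, |p o - q o| = |√(p o) - √(q o)| * (√(p o) + √(q o)) := fun o => by
    rw [← abs_of_nonneg (add_nonneg (Real.sqrt_nonneg (p o)) (Real.sqrt_nonneg (q o))), ← abs_mul]
    congr 1
    linear_combination hsq o - hsp o
  have hsub : ∑ o, |√(p o) - √(q o)| ^ 2 = 2 - 2 * ∑ o, √(p o * q o) := by
    have : ∀ o, |√(p o) - √(q o)| ^ 2 = p o + q o - 2 * √(p o * q o) := fun o => by
      rw [sq_abs, hmul]
      linear_combination hsp o + hsq o
    rw [sum_congr rfl fun o _ => this o, sum_sub_distrib, sum_add_distrib, ← mul_sum, hp.2, hq.2]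
    norm_num
  have hadd : ∑ o, (√(p o) + √(q o)) ^ 2 = 2 + 2 * ∑ o, √(p o * q o) := by
    have : ∀ o, (√(p o) + √(q o)) ^ 2 = p o + q o + 2 * √(p o * q o) := fun o => by
      rw [hmul]
      linear_combination hsp o + hsq o
    rw [sum_congr rfl fun o _ => this o, sum_add_distrib, sum_add_distrib, ← mul_sum, hp.2, hq.2]
    norm_num
  have hcs := sum_mul_sq_le_sq_mul_sq univ (fun o => |√(p o) - √(q o)|)
    (fun o => √(p o) + √(q o))
  rw [hsub, hadd, ← sum_congr rfl fun o _ => habs o] at hcs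
  linarith

/-- The Bhattacharyya coefficient is multiplicative on product distributions. -/
lemma sum_sqrt_tensorPow_mul {S O : Type*} [Fintype O] [DecidableEq O] {M : Matrix O S ℝ}
    (hM : ∀ o s, 0 ≤ M o s) (k : ℕ) (s t : S) :
    ∑ o, √(M.tensorPow k o s * M.tensorPow k o t) = (∑ o, √(M o s * M o t)) ^ k := by
  rw [Fintype.sum_pow]
  refine sum_congr rfl fun o _ => ?_
  simp only [Matrix.tensorPow, Matrix.of_apply]
  rw [← prod_mul_distrib,
    Real.sqrt_prod univ fun i _ => mul_nonneg (hM (o i) s) (hM (o i) t)]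

lemma Matrix.tensorPow_mem_stdSimplex {S O : Type*} [Fintype O] [DecidableEq O]
    {M : Matrix O S ℝ} (hM : ∀ s, (fun o => M o s) ∈ stdSimplex ℝ O) (k : ℕ) (s : S) :
    (fun o => M.tensorPow k o s) ∈ stdSimplex ℝ (Fin k → O) := by
  refine ⟨fun o => ?_, ?_⟩
  · simp only [Matrix.tensorPow, Matrix.of_apply]
    exact prod_nonneg fun i _ => (hM s).1 (o i)
  have h := Fintype.sum_pow (fun o => M o s) k
  rw [(hM s).2, one_pow] at h
  exact h.symm

/-- If the columns of a stochastic matrix have small pairwise Bhattacharyya coefficients, then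
maximum likelihood decoding gives a left inverse of `(1 → 1)` norm at most `2`. -/
lemma exists_leftInverse_of_sum_sqrt_le {S Ω : Type*} [Fintype S] [Nonempty S] [Fintype Ω]
    [DecidableEq S] [DecidableEq Ω] {T : Matrix Ω S ℝ}
    (hT : ∀ s, (fun o => T o s) ∈ stdSimplex ℝ Ω)
    (h : ∀ s t, s ≠ t → ∑ o, √(T o s * T o t) ≤ 1 / (4 * (Fintype.card S : ℝ))) :
    ∃ L : Matrix S Ω ℝ, L * T = 1 ∧ L.norm1to1 ≤ 2 := by
  -- `ψ` is the maximum likelihood decoder; ties may be broken arbitrarily.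
  choose ψ hψ using fun o : Ω => Finite.exists_max (T o)
  set D : Matrix S Ω ℝ := Matrix.of fun s o => if ψ o = s then 1 else 0 with hD
  have hDsum : ∀ o, ∑ s, |D s o| = 1 := fun o => by
    simp [hD, abs_ite]
  have hT0 : ∀ o s, 0 ≤ T o s := fun o s => (hT s).1 o
  have hDT : ∀ t s, (D * T) t s = ∑ o, if ψ o = t then T o s else 0 := fun t s => by
    simp [hD, Matrix.mul_apply]
  have hDT0 : ∀ t s, 0 ≤ (D * T) t s := fun t s => by
    rw [hDT]
    exact sum_nonneg fun o _ => by split_ifs <;> simp [hT0]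
  have hcol : ∀ s, ∑ t, (D * T) t s = 1 := fun s => by
    simp only [hDT]
    rw [sum_comm]
    simpa using (hT s).2
  have hoff : ∀ s t, t ≠ s → (D * T) t s ≤ 1 / (4 * (Fintype.card S : ℝ)) := fun s t hts => by
    rw [hDT]
    refine (sum_le_sum fun o _ => ?_).trans (h s t hts.symm)
    split_ifs with ho
    -- Where `t` is decoded, `T o s ≤ T o t`, so `T o s` is at most the geometric mean of the two.
    · refine Real.le_sqrt_of_sq_le ?_
      rw [sq]
      exact mul_le_mul_of_nonneg_left (ho ▸ hψ o s) (hT0 o s)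
    · exact Real.sqrt_nonneg _
  have hS : (0 : ℝ) < Fintype.card S := Nat.cast_pos.2 Fintype.card_pos
  have herr : ∀ s, ∑ t ∈ univ.erase s, (D * T) t s ≤ 1 / 4 := fun s => by
    calc ∑ t ∈ univ.erase s, (D * T) t s
        ≤ ∑ _t ∈ univ.erase s, 1 / (4 * (Fintype.card S : ℝ)) :=
          sum_le_sum fun t ht => hoff s t (ne_of_mem_erase ht)
      _ ≤ ∑ _t : S, 1 / (4 * (Fintype.card S : ℝ)) :=
          sum_le_sum_of_subset_of_nonneg (erase_subset _ _) fun _ _ _ => by positivity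
      _ = 1 / 4 := by
          rw [sum_const, card_univ, nsmul_eq_mul]
          field_simp
  -- Columns of `D * T` sum to 1, so the diagonal deficit equals the off-diagonal mass: the error
  -- `1/4` counts twice.
  have hE : ∀ s, ∑ t, |((1 : Matrix S S ℝ) - D * T) t s| ≤ 1 / 2 := fun s => by
    have hs := hcol s
    rw [← add_sum_erase univ _ (mem_univ s)] at hs ⊢
    have hoffdiag : ∑ t ∈ univ.erase s, |((1 : Matrix S S ℝ) - D * T) t s| =
        ∑ t ∈ univ.erase s, (D * T) t s :=
      sum_congr rfl fun t ht => by
        rw [Matrix.sub_apply, Matrix.one_apply_ne (ne_of_mem_erase ht), zero_sub, abs_neg,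
          abs_of_nonneg (hDT0 t s)]
    have hpos : 0 ≤ ∑ t ∈ univ.erase s, (D * T) t s := sum_nonneg fun t _ => hDT0 t s
    rw [hoffdiag, Matrix.sub_apply, Matrix.one_apply_eq, abs_of_nonneg (by linarith)]
    linarith [herr s]
  have hlow : ∀ x : S → ℝ, ∑ s, |x s| ≤ 2 * ∑ s, |(D * T).mulVec x s| := fun x => by
    have h1 := (1 - D * T).sum_abs_mulVec_le hE x
    have h2 : ∑ s, |x s| ≤ ∑ s, |(1 - D * T).mulVec x s| + ∑ s, |(D * T).mulVec x s| := by
      rw [← sum_add_distrib]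
      refine sum_le_sum fun s _ => ?_
      have : x s = (1 - D * T).mulVec x s + (D * T).mulVec x s := by
        rw [Matrix.sub_mulVec, Matrix.one_mulVec, Pi.sub_apply, sub_add_cancel]
      exact this ▸ abs_add_le _ _
    linarith
  have hunit : IsUnit (D * T) := by
    refine Matrix.mulVec_injective_iff_isUnit.1 fun x y hxy => ?_
    have hz := hlow (x - y)
    have hxy' : (D * T).mulVec (x - y) = 0 := by
      rw [Matrix.mulVec_sub, sub_eq_zero]
      exact hxy
    rw [hxy'] at hz
    funext s
    have := single_le_sum (f := fun s => |(x - y) s|) (fun _ _ => abs_nonneg _) (mem_univ s)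
    have h0 : |(x - y) s| ≤ 0 := this.trans (by simpa using hz)
    exact sub_eq_zero.1 (abs_nonpos_iff.1 h0)
  have hdet : IsUnit (D * T).det := (Matrix.isUnit_iff_isUnit_det _).1 hunit
  refine ⟨(D * T)⁻¹ * D, ?_, Matrix.norm1to1_le _ zero_le_two fun y => ?_⟩
  · rw [Matrix.mul_assoc, Matrix.nonsing_inv_mul _ hdet]
  -- Apply `hlow` to `(D * T)⁻¹ D y`: its image under `D * T` is `D y`, and `D` is an `ℓ¹`
  -- contraction.
  · refine (hlow _).trans (mul_le_mul_of_nonneg_left ?_ zero_le_two)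
    rw [Matrix.mulVec_mulVec, ← Matrix.mul_assoc, Matrix.mul_nonsing_inv _ hdet, Matrix.one_mul]
    simpa using D.sum_abs_mulVec_le (fun o => (hDsum o).le) y

/-- Exponential decay of powers of the Bhattacharyya coefficient of two distributions at `ℓ¹`
distance at least `α`. -/
lemma sum_sqrt_mul_pow_le_exp {O : Type*} [Fintype O] {p q : O → ℝ} (hp : p ∈ stdSimplex ℝ O)
    (hq : q ∈ stdSimplex ℝ O) {α : ℝ} (hα : 0 ≤ α) (h : α ≤ ∑ o, |p o - q o|) (k : ℕ) :
    (∑ o, √(p o * q o)) ^ k ≤ Real.exp (-(k * (α ^ 2 / 8))) := by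
  have hsq := sq_sum_sqrt_mul_le hp hq
  have hα2 : α ^ 2 ≤ (∑ o, |p o - q o|) ^ 2 := pow_le_pow_left₀ hα h 2
  -- From `1 - x ≤ exp (-x)` at `x = α²/4`; the square root halves the rate.
  have hexp : (∑ o, √(p o * q o)) ^ 2 ≤ Real.exp (-(α ^ 2 / 8)) ^ 2 := by
    rw [← Real.exp_nat_mul]
    refine le_trans ?_ (Real.add_one_le_exp _)
    push_cast
    linarith
  have hB : ∑ o, √(p o * q o) ≤ Real.exp (-(α ^ 2 / 8)) :=
    (abs_le_of_sq_le_sq' hexp (Real.exp_pos _).le).2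
  refine (pow_le_pow_left₀ (sum_nonneg fun o _ => Real.sqrt_nonneg _) hB k).trans_eq ?_
  rw [← Real.exp_nat_mul, mul_neg]

theorem mainTheorem1 :
    ∃ C : ℝ, 0 < C ∧
      ∀ (S A O : Type*) [Fintype S] [Fintype A] [Fintype O] [DecidableEq S] [DecidableEq O]
        (H : ℕ) (P : POMDP S A O H) (α : ℝ), 0 < α → α ≤ 1 → P.IsDistinguishable α →
        ∀ k : ℕ, 1 ≤ k →
          C * √(Fintype.card O : ℝ) * Real.log ((Fintype.card S : ℝ) * (Fintype.card O : ℝ)) / α ^ 2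
            ≤ (k : ℝ) →
          P.IsMORevealing (1 / 2) k := by
  -- `24 = 8 * 3`: the decay rate `α²/8`, and `log (4S) ≤ 3 log S` below.
  refine ⟨24, by norm_num, ?_⟩
  intro S A O _ _ _ _ _ H P α hα _ hdist k _ hk h
  have hS : Nonempty S := by
    by_contra hS
    rw [not_nonempty_iff] at hS
    simpa using P.init_mem.2
  have hem := P.emission_mem h
  rw [one_div, inv_inv]
  refine exists_leftInverse_of_sum_sqrt_le (Matrix.tensorPow_mem_stdSimplex hem k) ?_
  intro s t hst
  have hO : Nonempty O := by
    by_contra hO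
    rw [not_nonempty_iff] at hO
    simpa using (hem s).2
  have hO1 : (1 : ℝ) ≤ Fintype.card O := by exact_mod_cast Fintype.card_pos (α := O)
  have hS2 : (2 : ℝ) ≤ Fintype.card S := by
    exact_mod_cast Fintype.one_lt_card_iff.2 ⟨s, t, hst⟩
  have hd : α ≤ ∑ o, |P.emission h o s - P.emission h o t| := by
    have := hdist h s t hst
    rw [l1Norm_eq_sum] at this
    simpa [Matrix.mulVec_sub, Matrix.mulVec_single_one] using this
  rw [sum_sqrt_tensorPow_mul fun o s => (hem s).1 o]
  refine (sum_sqrt_mul_pow_le_exp (hem s) (hem t) hα.le hd k).trans ?_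
  have hlogS : 0 ≤ Real.log (Fintype.card S) := Real.log_nonneg (by linarith)
  have hlog : Real.log (Fintype.card S) ≤
      √(Fintype.card O : ℝ) * Real.log ((Fintype.card S : ℝ) * (Fintype.card O : ℝ)) := by
    have h1 : Real.log (Fintype.card S) ≤
        Real.log ((Fintype.card S : ℝ) * (Fintype.card O : ℝ)) :=
      Real.log_le_log (by linarith) (le_mul_of_one_le_right (by linarith) hO1)
    exact h1.trans (le_mul_of_one_le_left (hlogS.trans h1) (Real.one_le_sqrt.2 hO1))
  -- `4S ≤ S³` because the distinct states `s`, `t` force `S ≥ 2`.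
  have hlog4 : Real.log (4 * Fintype.card S) ≤ 3 * Real.log (Fintype.card S) := by
    have h3 : 3 * Real.log (Fintype.card S) = Real.log ((Fintype.card S : ℝ) ^ 3) := by
      rw [Real.log_pow]
      norm_num
    rw [h3]
    exact Real.log_le_log (by linarith)
      (by nlinarith [mul_le_mul hS2 hS2 zero_le_two (by linarith)])
  rw [div_le_iff₀ (by positivity)] at hk
  have hfin : Real.log (4 * Fintype.card S) ≤ k * (α ^ 2 / 8) := by linarith
  rw [Real.exp_neg, one_div]
  refine inv_anti₀ (by linarith) ?_
  rwa [← Real.log_le_iff_le_exp (by linarith)]
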